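/- Let $N\ge 2$, $\alpha>0$, $\tilde\epsilon>0$. Let $\widehat W\in\mathbb R^{n\times n}$ be symmetric with eigenvalues $\lambda_1>\lambda_2>\dots>\lambda_n>0$ ($n\ge 2$) and an eigendecomposition $\widehat W=V\Sigma V^{\top}$, $V$ orthogonal, $\Sigma=\mathrm{diag}(\lambda_1,\dots,\lambda_n)$, and let $\delta_s=\min_{i\ne j}|\lambda_i-\lambda_j|$. Let $E\in\mathbb R^{n\times n}$ be symmetric with spectral norm $\|E\|\le\delta_s/2$, and let $\widetilde W=\widehat W+E=\widetilde V\widetilde\Sigma\widetilde V^{\top}$ be an eigendecomposition, $\widetilde V$ orthogonal, $\widetilde\Sigma=\mathrm{diag}(\tilde\lambda_1,\dots,\tilde\lambda_n)$, $\tilde\lambda_1\ge\dots\ge\tilde\lambda_n$. Write $x_+=\max\{x,0\}$, $\Sigma_+=\mathrm{diag}((\lambda_i)_+)$ and $\widetilde\Sigma_+=\mathrm{diag}((\tilde\lambda_i)_+)$. Let $W_1(k),\dots,W_N(k)\in\mathbb R^{n\times n}$ be the gradient descent iterates $$W_j(k+1)=W_j(k)-\eta\,\nabla_{W_j}\widetilde{\mathcal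 L}(W_1(k),\dots,W_N(k)),\qquad W_j(0)=\alpha I,\qquad \widetilde{\mathcal L}(W_1,\dots,W_N)=\tfrac12\|W_N\cdots W_1-\widetilde W\|_F^2,$$ and let $W(k)=W_N(k)\cdots W_1(k)$. Let $M=\max\{\alpha,\|\widetilde W\|^{1/N}\}$ and assume $$0<\eta<\frac1{(3N-2)M^{2N-2}}.$$ Then $W(k)\to\widetilde V\widetilde\Sigma_+\widetilde V^{\top}$ as $k\to\infty$. Moreover, for every $i\in\{1,\dots,n\}$ and every integer $k\ge 0$ with $k\ge T_N^{\mathrm{Id}}(\tilde\lambda_i,\tilde\epsilon,\alpha,\eta)$, the diagonal entry $\mathcal E_{ii}(k)$ of $\mathcal E(k)=V^{\top}W(k)V-\Sigma_+$ satisfies $$|\mathcal E_{ii}(k)|\le\Big(\frac{4\sqrt2\,M^N}{\delta_s}+1\Big)\|E\|+\begin{cases}\tilde\epsilon\,N\,\tilde\lambda_i^{1-1/N}&\text{if }\tilde\lambda_i\ge\alpha^N,\\ (\tilde\lambda_i^{1/N}+\tilde\epsilon)^N-\tilde\lambda_i&\text{if }0<\tilde\lambda_i<\alpha^N,\\ \tilde\epsilon^{N}&\text{if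 }\tilde\lambda_i\le 0.\end{cases}$$ Here, with $c_N=\frac{N-1}{2N-1}$, $\mu=(c_N\lambda)^{1/N}$ and $F_\lambda(a,b)=\int_a^b\frac{dz}{z^{N-1}(\lambda-z^N)}$ (the time in which the flow $y'=y^{N-1}(\lambda-y^N)$ moves from $a$ to $b$), $$T_N^{\mathrm{Id}}(\lambda,\epsilon,\alpha,\eta)=\begin{cases}\frac1\eta F_\lambda(\alpha,\epsilon)&\text{if }\lambda\le0,\\[1ex] \min\Big\{\frac1\eta F_\lambda(\alpha,\lambda^{1/N}+\epsilon),\ \frac{\ln((\alpha-\lambda^{1/N})/\epsilon)}{|\ln(1-\eta N\lambda^{2-2/N})|}\Big\}&\text{if }0<\lambda<\alpha^N,\\[1.5ex] \frac{\ln((\lambda^{1/N}-\alpha)/\epsilon)}{|\ln(1-\eta N\alpha^{2N-2})|}\ \ (:=0\text{ if }\lambda=\alpha^N)&\text{if }c_N\lambda\le\alpha^N\le\lambda,\\[1.5ex] \frac1\eta F_\lambda(\alpha,\mu)+\Big\lceil\big(\tfrac{\mu}{\alpha}\big)^{N-1}\Big\rceil+\frac{\ln(\lambda^{1/N}/\epsilon)-|\ln(1-c_N^{1/N})|}{|\ln(1-\eta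 N\mu^{2N-2})|}&\text{if }\alpha^N<c_N\lambda.\end{cases}$$ -/

import Mathlib

open Filter Topology

noncomputable section

/-- The product `W_N ⋯ W_1` of the factors; the factor `W_j` is `W ⟨j - 1, _⟩`. -/
def factorProd {n N : ℕ} (W : Fin N → Matrix (Fin n) (Fin n) ℝ) : Matrix (Fin n) (Fin n) ℝ :=
  (List.ofFn W).reverse.prod

/-- The loss `½ ‖W_N ⋯ W_1 - Wt‖_F²` (Frobenius norm). -/
def factorLoss {n N : ℕ} (Wt : Matrix (Fin n) (Fin n) ℝ)
    (W : Fin N → Matrix (Fin n) (Fin n) ℝ) : ℝ :=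
  (1 / 2) * ∑ a, ∑ b, ((factorProd W - Wt) a b) ^ 2

/-- The gradient of the loss with respect to the `j`-th factor: the matrix of the partial
derivatives with respect to the entries of that factor, the other factors being fixed. -/
def factorGrad {n N : ℕ} (Wt : Matrix (Fin n) (Fin n) ℝ)
    (W : Fin N → Matrix (Fin n) (Fin n) ℝ) (j : Fin N) : Matrix (Fin n) (Fin n) ℝ :=
  Matrix.of fun a b =>
    deriv (fun t : ℝ =>
      factorLoss Wt (Function.update W j (W j + Matrix.single a b t))) 0

/-- Gradient descent with step size `η`, all factors being updated simultaneously, started at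
`W_j(0) = α I` for every `j`. -/
def gdFactors {n : ℕ} (N : ℕ) (Wt : Matrix (Fin n) (Fin n) ℝ) (α η : ℝ) :
    ℕ → Fin N → Matrix (Fin n) (Fin n) ℝ
  | 0 => fun _ => α • (1 : Matrix (Fin n) (Fin n) ℝ)
  | k + 1 => fun j =>
      gdFactors N Wt α η k j - η • factorGrad Wt (gdFactors N Wt α η k) j

/-- The product iterate `W(k) = W_N(k) ⋯ W_1(k)` of gradient descent. -/
def gdProd {n : ℕ} (N : ℕ) (Wt : Matrix (Fin n) (Fin n) ℝ) (α η : ℝ) (k : ℕ) :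
    Matrix (Fin n) (Fin n) ℝ :=
  factorProd (gdFactors N Wt α η k)

/-- The spectral norm: the operator norm for the Euclidean norm. -/
def specNorm {n : ℕ} (A : Matrix (Fin n) (Fin n) ℝ) : ℝ :=
  ‖Matrix.toEuclideanCLM (n := Fin n) (𝕜 := ℝ) A‖

/-- The time in which the scalar gradient flow `y' = y ^ (N - 1) (lam - y ^ N)` moves
from `a` to `b`. -/
def flowTime (N : ℕ) (lam a b : ℝ) : ℝ :=
  ∫ z in a..b, 1 / (z ^ (N - 1) * (lam - z ^ N))

/-- The constant `c_N = (N - 1) / (2 N - 1)`; the speed `y ^ (N - 1) (lam - y ^ N)` is largest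
at `y = (c_N lam) ^ (1 / N)`. -/
def cConst (N : ℕ) : ℝ := ((N : ℝ) - 1) / (2 * (N : ℝ) - 1)

/-- The iteration count `T_N^Id(lam, ε, α, η)` for the scalar dynamics
`d(k+1) = d(k) - η d(k) ^ (N - 1) (d(k) ^ N - lam)`, `d(0) = α`, to come within `ε` of
`max(lam, 0) ^ (1 / N)`. -/
def TId (N : ℕ) (lam ε α η : ℝ) : ℝ :=
  if lam ≤ 0 then
    flowTime N lam α ε / η
  else if lam < α ^ N then
    min (flowTime N lam α (lam ^ (1 / (N : ℝ)) + ε) / η)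
      (Real.log ((α - lam ^ (1 / (N : ℝ))) / ε)
        / |Real.log (1 - η * N * lam ^ (2 - 2 / (N : ℝ)))|)
  else if cConst N * lam ≤ α ^ N then
    Real.log ((lam ^ (1 / (N : ℝ)) - α) / ε) / |Real.log (1 - η * N * α ^ (2 * N - 2))|
  else
    flowTime N lam α ((cConst N * lam) ^ (1 / (N : ℝ))) / η
      + (⌈((cConst N * lam) ^ (1 / (N : ℝ)) / α) ^ (N - 1)⌉ : ℝ)
      + (Real.log (lam ^ (1 / (N : ℝ)) / ε) - |Real.log (1 - cConst N ^ (1 / (N : ℝ)))|)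
        / |Real.log (1 - η * N * (cConst N * lam) ^ (2 - 2 / (N : ℝ)))|

end

/-! Started at `α I`, gradient descent keeps all factors equal to one matrix `A`, diagonal in the
eigenbasis of the target `Wt`: for such an `A` the gradient in every factor is `A ^ (N - 1) * (A ^ N
- Wt)`, independently of the factor. Hence `W(k)` has eigenvalues `y(k) ^ N`, where each `y` follows
`y ↦ y - η y ^ (N - 1) (y ^ N - λ)` from `y(0) = α`, with `λ` an eigenvalue of `Wt` (`gdProd_eq`).

The step size keeps `y` monotone in `[0, M]`. For `λ = r ^ N > 0`, dividing `y ^ N - r ^ N` by `y -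
r` shows that the distance to `r` contracts by at least `1 - η N m ^ (2N - 2)`, where `m` is a lower
bound for `y` and `r`. Where this is weak, `y` is compared, as an explicit Euler scheme, with the
flow: a decreasing scheme is ahead of it (`euler_decreasing_le`), an increasing one lags by at most
`log (G (y k) / G (y 0))` steps while the speed `G` increases (`euler_increasing_le`). The speed
increases up to `μ`; beyond `μ` the contraction takes over (`scalar_gd_far`).

For the perturbation, write `Vᵀ W(k) V = Q diag(p) Qᵀ` with `Q = Vᵀ Vt` (here `Vt` is the perturbed
eigenbasis). The diagonal error is a rotation error, plus the scalar error, plus the eigenvalue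
shift. Weyl's inequality bounds the shift by `‖E‖`. The rotation error is at most `M ^ N (1 - Q i i
^ 2)`, and a Davis–Kahan argument with the gap `δ / 2` that Weyl leaves gives `1 - Q i i ^ 2 ≤ 2 ‖E‖
/ δ`. -/

/-! ### Scalar gradient descent: monotonicity and linear contraction. -/

/-- One step of scalar gradient descent contracts the distance to the positive fixed point. -/
theorem scalar_step_contract {N : ℕ} (hN : 2 ≤ N) {η M m d r : ℝ} (hη : 0 < η)
    (hM : η * N * M ^ (2 * N - 2) ≤ 1) (hm : 0 ≤ m) (hmd : m ≤ d) (hmr : m ≤ r)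
    (hd : d ≤ M) (hr : r ≤ M) :
    ∃ q, 0 ≤ q ∧ q ≤ 1 - η * N * m ^ (2 * N - 2) ∧
      d - η * (d ^ (N - 1) * (d ^ N - r ^ N)) - r = (d - r) * q := by
  set S := ∑ i ∈ Finset.range N, d ^ i * r ^ (N - 1 - i) with hS
  have hgeom : S * (d - r) = d ^ N - r ^ N := geom_sum₂_mul d r N
  have hd0 : 0 ≤ d := hm.trans hmd
  have hr0 : 0 ≤ r := hm.trans hmr
  have hM0 : 0 ≤ M := hd0.trans hd
  have hlow : N * m ^ (N - 1) ≤ S := by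
    calc (N : ℝ) * m ^ (N - 1) = ∑ _i ∈ Finset.range N, m ^ (N - 1) := by simp
      _ ≤ S := by
        refine Finset.sum_le_sum fun i hi => ?_
        have : N - 1 = i + (N - 1 - i) := by have := Finset.mem_range.1 hi; omega
        rw [this, pow_add, ← this]
        gcongr
  have hup : S ≤ N * M ^ (N - 1) := by
    calc S ≤ ∑ _i ∈ Finset.range N, M ^ (N - 1) := by
          refine Finset.sum_le_sum fun i hi => ?_
          have : N - 1 = i + (N - 1 - i) := by have := Finset.mem_range.1 hi; omega
          rw [this, pow_add, ← this]
          gcongr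
      _ = N * M ^ (N - 1) := by simp
  have hexp : 2 * N - 2 = (N - 1) + (N - 1) := by omega
  have hS0 : 0 ≤ S := (by positivity : (0 : ℝ) ≤ N * m ^ (N - 1)).trans hlow
  -- With `d ^ N - r ^ N = S (d - r)` the step is exactly multiplication of `d - r` by this factor;
  -- the bounds on `S` and `d` do the rest.
  refine ⟨1 - η * (d ^ (N - 1) * S), ?_, ?_, ?_⟩
  · have : d ^ (N - 1) * S ≤ M ^ (N - 1) * (N * M ^ (N - 1)) := by gcongr
    have h2 := mul_le_mul_of_nonneg_left this hη.le
    rw [hexp, pow_add] at hM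
    linarith
  · have : m ^ (N - 1) * (N * m ^ (N - 1)) ≤ d ^ (N - 1) * S := by gcongr
    have h2 := mul_le_mul_of_nonneg_left this hη.le
    rw [hexp, pow_add]
    linarith
  · rw [← hgeom]; ring

/-- Scalar gradient descent started below the fixed point increases to it linearly. -/
theorem scalar_gd_below {N : ℕ} (hN : 2 ≤ N) {η M r : ℝ} (hη : 0 < η)
    (hM : η * N * M ^ (2 * N - 2) ≤ 1) (hr : r ≤ M) {y : ℕ → ℝ}
    (hy : ∀ k, y (k + 1) = y k - η * (y k ^ (N - 1) * (y k ^ N - r ^ N)))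
    (h0 : 0 ≤ y 0) (h0r : y 0 ≤ r) (k : ℕ) :
    y 0 ≤ y k ∧ y k ≤ r ∧ y k ≤ y (k + 1) ∧
      r - y k ≤ (r - y 0) * (1 - η * N * y 0 ^ (2 * N - 2)) ^ k := by
  have step : ∀ d, y 0 ≤ d → d ≤ r → ∃ q, 0 ≤ q ∧ q ≤ 1 - η * N * y 0 ^ (2 * N - 2) ∧
      d - η * (d ^ (N - 1) * (d ^ N - r ^ N)) - r = (d - r) * q := fun d h1 h2 =>
    scalar_step_contract hN hη hM h0 h1 h0r (h2.trans hr) hr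
  have hnn : 0 ≤ η * N * y 0 ^ (2 * N - 2) := by positivity
  have mono : ∀ k, y 0 ≤ y k → y k ≤ r → y k ≤ y (k + 1) := by
    intro k h1 h2
    obtain ⟨q, hq0, hq1, hq⟩ := step (y k) h1 h2
    rw [← hy] at hq
    nlinarith
  have main : y 0 ≤ y k ∧ y k ≤ r ∧
      r - y k ≤ (r - y 0) * (1 - η * N * y 0 ^ (2 * N - 2)) ^ k := by
    induction k with
    | zero => simpa using h0r
    | succ k ih =>
      obtain ⟨h1, h2, h3⟩ := ih
      have hm := mono k h1 h2
      obtain ⟨q, hq0, hq1, hq⟩ := step (y k) h1 h2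
      rw [← hy] at hq
      refine ⟨h1.trans hm, by nlinarith, ?_⟩
      calc r - y (k + 1) = (r - y k) * q := by linarith
        _ ≤ (r - y 0) * (1 - η * N * y 0 ^ (2 * N - 2)) ^ k
              * (1 - η * N * y 0 ^ (2 * N - 2)) :=
            mul_le_mul h3 hq1 hq0 ((sub_nonneg.2 h2).trans h3)
        _ = _ := by ring
  exact ⟨main.1, main.2.1, mono k main.1 main.2.1, main.2.2⟩

/-- Scalar gradient descent started above the fixed point decreases to it linearly. -/
theorem scalar_gd_above {N : ℕ} (hN : 2 ≤ N) {η M r : ℝ} (hη : 0 < η)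
    (hM : η * N * M ^ (2 * N - 2) ≤ 1) (hr : 0 ≤ r) {y : ℕ → ℝ}
    (hy : ∀ k, y (k + 1) = y k - η * (y k ^ (N - 1) * (y k ^ N - r ^ N)))
    (h0 : y 0 ≤ M) (h0r : r ≤ y 0) (k : ℕ) :
    y k ≤ y 0 ∧ r ≤ y k ∧ y (k + 1) ≤ y k ∧
      y k - r ≤ (y 0 - r) * (1 - η * N * r ^ (2 * N - 2)) ^ k := by
  have step : ∀ d, d ≤ y 0 → r ≤ d → ∃ q, 0 ≤ q ∧ q ≤ 1 - η * N * r ^ (2 * N - 2) ∧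
      d - η * (d ^ (N - 1) * (d ^ N - r ^ N)) - r = (d - r) * q := fun d h1 h2 =>
    scalar_step_contract hN hη hM hr h2 le_rfl (h1.trans h0) (h0r.trans h0)
  have hnn : 0 ≤ η * N * r ^ (2 * N - 2) := by positivity
  have mono : ∀ k, y k ≤ y 0 → r ≤ y k → y (k + 1) ≤ y k := by
    intro k h1 h2
    obtain ⟨q, hq0, hq1, hq⟩ := step (y k) h1 h2
    rw [← hy] at hq
    nlinarith
  have main : y k ≤ y 0 ∧ r ≤ y k ∧
      y k - r ≤ (y 0 - r) * (1 - η * N * r ^ (2 * N - 2)) ^ k := by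
    induction k with
    | zero => simpa using h0r
    | succ k ih =>
      obtain ⟨h1, h2, h3⟩ := ih
      have hm := mono k h1 h2
      obtain ⟨q, hq0, hq1, hq⟩ := step (y k) h1 h2
      rw [← hy] at hq
      refine ⟨hm.trans h1, by nlinarith, ?_⟩
      calc y (k + 1) - r = (y k - r) * q := by linarith
        _ ≤ (y 0 - r) * (1 - η * N * r ^ (2 * N - 2)) ^ k
              * (1 - η * N * r ^ (2 * N - 2)) :=
            mul_le_mul h3 hq1 hq0 ((sub_nonneg.2 h2).trans h3)
        _ = _ := by ring
  exact ⟨main.1, main.2.1, mono k main.1 main.2.1, main.2.2⟩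

/-- With a nonpositive target, scalar gradient descent stays positive and decreases. -/
theorem scalar_gd_nonpos {N : ℕ} (hN : 2 ≤ N) {η M lam : ℝ} (hη : 0 < η)
    (hM : 2 * η * M ^ (2 * N - 2) ≤ 1) (hlam : lam ≤ 0) (hlamM : -lam ≤ M ^ N) {y : ℕ → ℝ}
    (hy : ∀ k, y (k + 1) = y k - η * (y k ^ (N - 1) * (y k ^ N - lam)))
    (h0 : 0 ≤ y 0) (h0M : y 0 ≤ M) (k : ℕ) : 0 ≤ y k ∧ y k ≤ y 0 ∧ y (k + 1) ≤ y k := by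
  have mono : ∀ k, 0 ≤ y k → y (k + 1) ≤ y k := by
    intro k h
    have : 0 ≤ η * (y k ^ (N - 1) * (y k ^ N - lam)) := by
      have : 0 ≤ y k ^ N := by positivity
      have : 0 ≤ y k ^ N - lam := by linarith
      positivity
    rw [hy]; linarith
  have main : 0 ≤ y k ∧ y k ≤ y 0 := by
    induction k with
    | zero => exact ⟨h0, le_rfl⟩
    | succ k ih =>
      obtain ⟨h1, h2⟩ := ih
      refine ⟨?_, (mono k h1).trans h2⟩
      have e1 : N - 1 = (N - 2) + 1 := by omega
      have hM0 : 0 ≤ M := h0.trans h0M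
      have hyM := h2.trans h0M
      -- The step multiplies `y k` by `1 - η` times this quantity. Both `y k ^ N` and `-lam` may
      -- reach `M ^ N`, hence the factor 2 in `hM`.
      have : y k ^ (N - 2) * (y k ^ N - lam) ≤ M ^ (N - 2) * (M ^ N + M ^ N) := by
        have : y k ^ N ≤ M ^ N := by gcongr
        have : 0 ≤ y k ^ N := by positivity
        have : 0 ≤ y k ^ N - lam := by linarith
        gcongr
        linarith
      have h3 := mul_le_mul_of_nonneg_left this hη.le
      have e2 : M ^ (2 * N - 2) = M ^ (N - 2) * M ^ N := by rw [← pow_add]; congr 1; omega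
      rw [e2] at hM
      have : y (k + 1) = y k * (1 - η * (y k ^ (N - 2) * (y k ^ N - lam))) := by
        rw [hy, e1, pow_succ]; ring
      rw [this]
      apply mul_nonneg h1
      nlinarith
  exact ⟨main.1, main.2, mono k main.1⟩

/-! ### Step counts: geometric decay, and Euler schemes against the flow. -/

/-- The number of steps after which a geometric bound falls below `ε`. -/
theorem mul_pow_le_of_log_div_le {q A ε : ℝ} {k : ℕ} (hq : 0 < q) (hq1 : q < 1) (hA : 0 ≤ A)
    (hε : 0 < ε) (hk : Real.log (A / ε) / |Real.log q| ≤ k) : A * q ^ k ≤ ε := by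
  -- The case `A = 0` is a start at the fixed point: `Real.log 0 = 0` makes the required count 0.
  rcases hA.eq_or_lt with rfl | hA
  · simpa using hε.le
  have hl : Real.log q < 0 := Real.log_neg hq hq1
  rw [abs_of_neg hl, div_le_iff₀ (by linarith), Real.log_div hA.ne' hε.ne'] at hk
  rw [← Real.log_le_log_iff (by positivity) hε, Real.log_mul hA.ne' (by positivity), Real.log_pow]
  linarith

/-- A decreasing explicit Euler scheme is ahead of the flow. -/
theorem euler_decreasing_le {G : ℝ → ℝ} {η b : ℝ} (hG : ContinuousOn G (Set.Ici b))
    (hGm : MonotoneOn G (Set.Ici b)) (hGpos : ∀ z ∈ Set.Ici b, 0 < G z) {y : ℕ → ℝ}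
    (hy : ∀ k, y (k + 1) = y k - η * G (y k)) (hanti : Antitone y) (k : ℕ)
    (hk : η * k ≥ ∫ z in b..(y 0), 1 / G z) : y k ≤ b := by
  -- No order between `b` and `y 0` is assumed; the negation gives `b < y k ≤ y 0`, so that all
  -- iterates up to `k` lie where `G` is positive and increasing.
  by_contra! hlt
  have hint : ∀ u v, b ≤ u → b ≤ v → IntervalIntegrable (fun z => 1 / G z) MeasureTheory.volume u v := by
    intro u v hu hv
    apply ContinuousOn.intervalIntegrable
    have hsub : Set.uIcc u v ⊆ Set.Ici b := fun z hz => (le_min hu hv).trans hz.1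
    exact continuousOn_const.div (hG.mono hsub) fun z hz => (hGpos z (hsub hz)).ne'
  have key : ∀ j, b ≤ y j → η * j ≤ ∫ z in (y j)..(y 0), 1 / G z := by
    intro j
    induction j with
    | zero => simp
    | succ j ih =>
      intro hj
      have hle : y (j + 1) ≤ y j := hanti (Nat.le_succ j)
      have hj' : b ≤ y j := hj.trans hle
      have h0 : b ≤ y 0 := hj'.trans (hanti (Nat.zero_le j))
      have h1 := ih hj'
      have hpos := hGpos _ hj'
      -- On this interval the flow is never faster than `G (y j)`, so it needs at least time `η` for
      -- what the scheme does in one step.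
      have h2 : (∫ z in (y (j + 1))..(y j), 1 / G (y j)) ≤ ∫ z in (y (j + 1))..(y j), 1 / G z := by
        apply intervalIntegral.integral_mono_on hle (by simp) (hint _ _ hj hj')
        intro z hz
        exact one_div_le_one_div_of_le (hGpos z (hj.trans hz.1))
          (hGm (hj.trans hz.1) hj' hz.2)
      rw [intervalIntegral.integral_const, smul_eq_mul, hy j] at h2
      have h3 : (y j - (y j - η * G (y j))) * (1 / G (y j)) = η := by field_simp; ring
      rw [h3, ← hy] at h2
      rw [← intervalIntegral.integral_add_adjacent_intervals (hint _ (y j) hj hj') (hint _ _ hj' h0)]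
      push_cast
      linarith
  have h1 := key k hlt.le
  have h0 : b ≤ y 0 := hlt.le.trans (hanti (Nat.zero_le k))
  rw [← intervalIntegral.integral_add_adjacent_intervals (hint b (y k) le_rfl hlt.le)
    (hint _ _ hlt.le h0)] at hk
  have : 0 < ∫ z in b..(y k), 1 / G z :=
    intervalIntegral.intervalIntegral_pos_of_pos_on (hint _ _ le_rfl hlt.le)
      (fun z hz => one_div_pos.2 (hGpos z hz.1.le)) hlt
  linarith

/-- An increasing explicit Euler scheme lags behind the flow by at most logarithmically
many steps. -/
theorem euler_increasing_le {G : ℝ → ℝ} {η m : ℝ} {y : ℕ → ℝ}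
    (hG : ContinuousOn G (Set.Icc (y 0) m))
    (hGm : MonotoneOn G (Set.Icc (y 0) m)) (hGpos : ∀ z ∈ Set.Icc (y 0) m, 0 < G z)
    (hy : ∀ k, y (k + 1) = y k + η * G (y k)) (hmono : Monotone y) (hη : 0 < η) (k : ℕ)
    (hk : y k ≤ m) :
    η * k ≤ (∫ z in (y 0)..(y k), 1 / G z) + η * Real.log (G (y k) / G (y 0)) := by
  induction k with
  | zero =>
    have := hGpos (y 0) ⟨le_rfl, hk⟩
    simp [this.ne']
  | succ j ih =>
    have hle : y j ≤ y (j + 1) := hmono (Nat.le_succ j)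
    have hj : y j ≤ m := hle.trans hk
    have h0j : y 0 ≤ y j := hmono (Nat.zero_le j)
    have h1 := ih hj
    have hint : ∀ u v, y 0 ≤ u → u ≤ v → v ≤ m →
        IntervalIntegrable (fun z => 1 / G z) MeasureTheory.volume u v := by
      intro u v hu huv hv
      apply ContinuousOn.intervalIntegrable
      have hsub : Set.uIcc u v ⊆ Set.Icc (y 0) m := by
        rw [Set.uIcc_of_le huv]; exact Set.Icc_subset_Icc hu hv
      exact continuousOn_const.div (hG.mono hsub) fun z hz => (hGpos z (hsub hz)).ne'
    have p0 := hGpos (y 0) ⟨le_rfl, h0j.trans hj⟩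
    have pj := hGpos (y j) ⟨h0j, hj⟩
    have pj' := hGpos (y (j + 1)) ⟨h0j.trans hle, hk⟩
    have h2 : (∫ z in (y j)..(y (j + 1)), 1 / G (y (j + 1))) ≤ ∫ z in (y j)..(y (j + 1)), 1 / G z := by
      apply intervalIntegral.integral_mono_on hle (by simp) (hint _ _ h0j hle hk)
      intro z hz
      have hz' : z ∈ Set.Icc (y 0) m := ⟨h0j.trans hz.1, hz.2.trans hk⟩
      exact one_div_le_one_div_of_le (hGpos z hz') (hGm hz' ⟨h0j.trans hle, hk⟩ hz.2)
    rw [intervalIntegral.integral_const, smul_eq_mul] at h2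
    have h3 : (y (j + 1) - y j) * (1 / G (y (j + 1))) = η * (G (y j) / G (y (j + 1))) := by
      rw [show y (j + 1) - y j = η * G (y j) by rw [hy]; ring]; ring
    rw [h3] at h2
    -- One step takes the flow at least `η G (y j) / G (y (j + 1))`. The shortfall from `η` is at
    -- most `η log (G (y (j + 1)) / G (y j))`, which telescopes.
    have h4 := Real.log_le_sub_one_of_pos (div_pos pj pj')
    rw [Real.log_div pj.ne' pj'.ne'] at h4
    rw [Real.log_div pj.ne' p0.ne'] at h1
    rw [Real.log_div pj'.ne' p0.ne',
      ← intervalIntegral.integral_add_adjacent_intervals (hint _ _ le_rfl h0j hj)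
        (hint _ _ h0j hle hk)]
    have h5 := mul_le_mul_of_nonneg_left h4 hη.le
    push_cast
    linarith

/-! ### The region of increasing speed and the approach from far below. -/

/-- Each of the `N` terms of the quotient `(z ^ N - x ^ N) / (z - x)` is at most `z ^ (N - 1)`. This
turns accuracy `ε` for the root into accuracy `ε N λ ^ (1 - 1/N)` for its power. -/
theorem pow_sub_pow_le_mul_sub {x z : ℝ} (hx : 0 ≤ x) (hxz : x ≤ z) (N : ℕ) :
    z ^ N - x ^ N ≤ N * z ^ (N - 1) * (z - x) := by
  rw [← geom_sum₂_mul z x N]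
  refine mul_le_mul_of_nonneg_right ?_ (sub_nonneg.2 hxz)
  calc ∑ i ∈ Finset.range N, z ^ i * x ^ (N - 1 - i)
      ≤ ∑ _i ∈ Finset.range N, z ^ (N - 1) := by
        refine Finset.sum_le_sum fun i hi => ?_
        have : N - 1 = i + (N - 1 - i) := by have := Finset.mem_range.1 hi; omega
        rw [this, pow_add, ← this]
        have := hx.trans hxz
        gcongr
    _ = N * z ^ (N - 1) := by simp

/-- The speed `z ^ (N - 1) (r ^ N - z ^ N)` increases up to `(c_N) ^ (1 / N) r`. -/
theorem flowSpeed_monotoneOn {N : ℕ} (hN : 2 ≤ N) {r m : ℝ}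
    (hm : (2 * (N : ℝ) - 1) * m ^ N ≤ ((N : ℝ) - 1) * r ^ N) :
    MonotoneOn (fun z : ℝ => z ^ (N - 1) * (r ^ N - z ^ N)) (Set.Icc 0 m) := by
  obtain ⟨p, rfl⟩ : ∃ p, N = p + 2 := ⟨N - 2, by omega⟩
  apply monotoneOn_of_deriv_nonneg (convex_Icc 0 m) (by fun_prop) (by fun_prop)
  intro z hz
  rw [interior_Icc] at hz
  have hd : HasDerivAt (fun z : ℝ => z ^ (p + 1) * (r ^ (p + 2) - z ^ (p + 2)))
      (((p + 1 : ℕ) : ℝ) * z ^ p * (r ^ (p + 2) - z ^ (p + 2))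
        + z ^ (p + 1) * (-(((p + 2 : ℕ) : ℝ) * z ^ (p + 1)))) z := by
    have h1 := hasDerivAt_pow (p + 1) z
    have h2 := (hasDerivAt_pow (p + 2) z).const_sub (r ^ (p + 2))
    exact h1.mul h2
  have h3 : z ^ (p + 2) ≤ m ^ (p + 2) := pow_le_pow_left₀ hz.1.le hz.2.le _
  have h4 : 0 ≤ z ^ p := pow_nonneg hz.1.le _
  change 0 ≤ deriv (fun z : ℝ => z ^ (p + 1) * (r ^ (p + 2) - z ^ (p + 2))) z
  rw [hd.deriv]
  push_cast at hm ⊢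
  -- The derivative is `z ^ p` times this expression, with `p + 1 = N - 1` and `2 p + 3 = 2 N - 1`;
  -- this is the origin of `c_N`.
  have h5 : 0 ≤ ((p : ℝ) + 1) * r ^ (p + 2) - (2 * p + 3) * z ^ (p + 2) := by
    nlinarith [(Nat.cast_nonneg p : (0 : ℝ) ≤ p)]
  have h6 := mul_nonneg h4 h5
  calc (0 : ℝ) ≤ _ := h6
    _ = _ := by ring

/-- The number of gradient descent steps spent below a point of the region where the speed is
increasing. -/
theorem scalar_gd_steps_le {N : ℕ} (hN : 2 ≤ N) {η r m : ℝ} (hη : 0 < η) (hm0 : 0 < m)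
    (hmr : m < r) (hm : (2 * (N : ℝ) - 1) * m ^ N ≤ ((N : ℝ) - 1) * r ^ N) {y : ℕ → ℝ}
    (hy : ∀ k, y (k + 1) = y k - η * (y k ^ (N - 1) * (y k ^ N - r ^ N)))
    (hmono : Monotone y) (h0 : 0 < y 0) {k : ℕ} (hk : y k ≤ m) :
    η * k ≤ flowTime N (r ^ N) (y 0) (y k) + η * ((m / y 0) ^ (N - 1) - 1) := by
  set G : ℝ → ℝ := fun z => z ^ (N - 1) * (r ^ N - z ^ N) with hG
  have hmon := flowSpeed_monotoneOn hN hm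
  have h0k := hmono (Nat.zero_le k)
  have hsub : Set.Icc (y 0) m ⊆ Set.Icc 0 m := Set.Icc_subset_Icc_left h0.le
  have hlt : ∀ z, 0 ≤ z → z ≤ m → z ^ N < r ^ N := fun z hz hzm =>
    pow_lt_pow_left₀ (hzm.trans_lt hmr) hz (by omega)
  have hpos : ∀ z ∈ Set.Icc (y 0) m, 0 < G z := fun z hz => by
    have h1 := h0.trans_le hz.1
    exact mul_pos (pow_pos h1 _) (sub_pos.2 (hlt z h1.le hz.2))
  have h1 := euler_increasing_le (G := G) (η := η) (m := m) (y := y) (by fun_prop)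
    (hmon.mono hsub) hpos (fun j => by rw [hy, hG]; ring) hmono hη k hk
  refine h1.trans (add_le_add le_rfl (mul_le_mul_of_nonneg_left ?_ hη.le))
  have p0 := hpos _ ⟨le_rfl, h0k.trans hk⟩
  have pk := hpos _ ⟨h0k, hk⟩
  -- The logarithmic lag is bounded by the speed ratio minus 1. Since `r ^ N - z ^ N` decreases in
  -- `z`, that ratio is at most `(m / y 0) ^ (N - 1)`.
  refine (Real.log_le_sub_one_of_pos (div_pos pk p0)).trans (sub_le_sub_right ?_ 1)
  rw [div_le_iff₀ p0, div_pow, hG]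
  have e : m ^ (N - 1) / y 0 ^ (N - 1) * (y 0 ^ (N - 1) * (r ^ N - y 0 ^ N))
      = m ^ (N - 1) * (r ^ N - y 0 ^ N) := by
    field_simp
  simp only [e]
  have hyk : 0 < y k := h0.trans_le h0k
  have := hlt _ hyk.le hk
  apply mul_le_mul
  · gcongr
  · gcongr
  · linarith
  · positivity

/-- Scalar gradient descent from far below the fixed point `r`. -/
theorem scalar_gd_far {N : ℕ} (hN : 2 ≤ N) {η M r m ε : ℝ} (hη : 0 < η) (hε : 0 < ε)
    (hM : η * N * M ^ (2 * N - 2) < 1) (hr : r ≤ M) (hm0 : 0 < m) (hmr : m < r)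
    (hm : (2 * (N : ℝ) - 1) * m ^ N ≤ ((N : ℝ) - 1) * r ^ N) {y : ℕ → ℝ}
    (hy : ∀ k, y (k + 1) = y k - η * (y k ^ (N - 1) * (y k ^ N - r ^ N)))
    (h0 : 0 < y 0) (h0m : y 0 < m) {k : ℕ}
    (hk : flowTime N (r ^ N) (y 0) m / η + (⌈(m / y 0) ^ (N - 1)⌉ : ℝ)
      + Real.log ((r - m) / ε) / |Real.log (1 - η * N * m ^ (2 * N - 2))| ≤ k) :
    r ^ N - y k ^ N ≤ N * r ^ (N - 1) * ε := by
  have hr0 : 0 < r := hm0.trans hmr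
  have hbelow := scalar_gd_below hN hη hM.le hr hy h0.le (h0m.trans hmr).le
  have hmono : Monotone y := monotone_nat_of_le_succ fun k => (hbelow k).2.2.1
  have hceil : (m / y 0) ^ (N - 1) ≤ (⌈(m / y 0) ^ (N - 1)⌉ : ℝ) := Int.le_ceil _
  set C : ℝ := (⌈(m / y 0) ^ (N - 1)⌉ : ℝ)
  have hN0 : (0 : ℝ) < N := by exact_mod_cast (by omega : 0 < N)
  set x := η * N * m ^ (2 * N - 2) with hx
  have hx0 : 0 < x := by positivity
  have hx1 : x < 1 := by
    refine lt_of_le_of_lt ?_ hM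
    have : m ≤ M := hmr.le.trans hr
    rw [hx]; gcongr
  have hlog : Real.log (1 - x) < 0 := Real.log_neg (by linarith) (by linarith)
  have hlogx : x ≤ |Real.log (1 - x)| := by
    rw [abs_of_neg hlog]
    have := Real.log_le_sub_one_of_pos (show 0 < 1 - x by linarith)
    linarith
  have hfin : ∀ j, r - y j ≤ ε → r ^ N - y j ^ N ≤ N * r ^ (N - 1) * ε := by
    intro j hj
    have h1 := pow_sub_pow_le_mul_sub (h0.le.trans (hbelow j).1) (hbelow j).2.1 N
    refine h1.trans ?_
    gcongr
  have hmpos : ∀ z, 0 < z → z ≤ m → 0 < z ^ (N - 1) * (r ^ N - z ^ N) := fun z hz hzm =>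
    mul_pos (pow_pos hz _) (sub_pos.2 (pow_lt_pow_left₀ (hzm.trans_lt hmr) hz.le (by omega)))
  have hint : ∀ u v, 0 < u → u ≤ v → v ≤ m → IntervalIntegrable
      (fun z : ℝ => 1 / (z ^ (N - 1) * (r ^ N - z ^ N))) MeasureTheory.volume u v := by
    intro u v hu huv hv
    apply ContinuousOn.intervalIntegrable
    rw [Set.uIcc_of_le huv]
    exact continuousOn_const.div (by fun_prop) fun z hz =>
      (hmpos z (hu.trans_le hz.1) (hz.2.trans hv)).ne'
  have hsplit : ∀ j, y j ≤ m → flowTime N (r ^ N) (y 0) (y j)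
      + (m - y j) / (m ^ (N - 1) * (r ^ N - m ^ N)) ≤ flowTime N (r ^ N) (y 0) m := by
    intro j hj
    have h0j := (hbelow j).1
    have hj0 := h0.trans_le h0j
    unfold flowTime
    rw [← intervalIntegral.integral_add_adjacent_intervals (hint _ _ h0 h0j hj)
      (hint _ _ hj0 hj le_rfl)]
    have : (∫ _z in (y j)..m, 1 / (m ^ (N - 1) * (r ^ N - m ^ N)))
        ≤ ∫ z in (y j)..m, 1 / (z ^ (N - 1) * (r ^ N - z ^ N)) := by
      apply intervalIntegral.integral_mono_on hj (by simp) (hint _ _ hj0 hj le_rfl)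
      intro z hz
      have hz0 := hj0.trans_le hz.1
      exact one_div_le_one_div_of_le (hmpos z hz0 hz.2)
        (flowSpeed_monotoneOn hN hm ⟨hz0.le, hz.2⟩ ⟨hm0.le, le_rfl⟩ hz.2)
    rw [intervalIntegral.integral_const, smul_eq_mul, mul_one_div] at this
    linarith
  have hsteps : ∀ j, y j ≤ m →
      (j : ℝ) ≤ flowTime N (r ^ N) (y 0) (y j) / η + (C - 1) := by
    intro j hj
    have h1 := scalar_gd_steps_le hN hη hm0 hmr hm hy hmono h0 hj
    have h2 : η * ((m / y 0) ^ (N - 1) - 1) ≤ η * (C - 1) := by gcongr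
    have h3 : η * j ≤ η * (flowTime N (r ^ N) (y 0) (y j) / η + (C - 1)) := by
      rw [mul_add, mul_div_cancel₀ _ hη.ne']; linarith
    exact le_of_mul_le_mul_left h3 hη
  have hgm := hmpos m hm0 le_rfl
  -- The logarithmic term of `hk` is negative when `ε > r - m`, so `k` may precede the passage
  -- through `m`. The conclusion must therefore also be proved below `m`, where `r - y k ≤ ε` is not
  -- available.
  by_cases hkm : m ≤ y k
  · rcases le_total ε (r - m) with hle | hle
    · -- the first index beyond `m`
      have hex : ∃ j, m ≤ y j := ⟨k, hkm⟩
      set k₀ := Nat.find hex with hk₀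
      have hk₀m : m ≤ y k₀ := Nat.find_spec hex
      have hk₀k : k₀ ≤ k := Nat.find_min' hex hkm
      have hk₀pos : k₀ ≠ 0 := by
        intro h; rw [h] at hk₀m; linarith
      have hprev : y (k₀ - 1) < m := not_le.1 (Nat.find_min hex (by omega))
      have h1 := hsteps _ hprev.le
      have h2 := hsplit _ hprev.le
      have h3 : 0 ≤ (m - y (k₀ - 1)) / (m ^ (N - 1) * (r ^ N - m ^ N)) :=
        div_nonneg (sub_nonneg.2 hprev.le) hgm.le
      have h4 : flowTime N (r ^ N) (y 0) (y (k₀ - 1)) / η ≤ flowTime N (r ^ N) (y 0) m / η := by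
        gcongr; linarith
      have h5 : ((k₀ - 1 : ℕ) : ℝ) = k₀ - 1 := by
        rw [Nat.cast_sub (by omega)]; simp
      rw [h5] at h1
      obtain ⟨j, hj⟩ := Nat.exists_eq_add_of_le hk₀k
      -- The `- 1` in `hsteps` pays for the step from `k₀ - 1` to `k₀`, so `k₀` is at most the flow
      -- time over `η` plus `C`, and the logarithmic term remains for `j = k - k₀`.
      have h6 : Real.log ((r - m) / ε) / |Real.log (1 - x)| ≤ j := by
        rw [hj] at hk; push_cast at hk; linarith
      have h7 := mul_pow_le_of_log_div_le (by linarith) (by linarith) (by linarith) hε h6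
      have h8 := (scalar_gd_below hN hη hM.le hr (y := fun i => y (k₀ + i))
        (fun i => hy (k₀ + i)) (hm0.le.trans hk₀m) (hbelow k₀).2.1 j).2.2.2
      simp only [add_zero, ← hj] at h8
      apply hfin
      refine h8.trans (le_trans ?_ h7)
      have h9 : y k₀ ≤ r := (hbelow k₀).2.1
      have h10 : 0 ≤ 1 - η * N * y k₀ ^ (2 * N - 2) := by
        have : η * N * y k₀ ^ (2 * N - 2) ≤ η * N * M ^ (2 * N - 2) := by
          have := h9.trans hr
          have := hm0.le.trans hk₀m
          gcongr
        linarith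
      have h11 : 1 - η * N * y k₀ ^ (2 * N - 2) ≤ 1 - x := by
        rw [hx]; gcongr
      gcongr
    · exact hfin k (by linarith)
  · push Not at hkm
    have h1 := hsteps k hkm.le
    have h2 := hsplit k hkm.le
    have hyk : 0 < y k := h0.trans_le (hbelow k).1
    have hrm : 0 < r - m := sub_pos.2 hmr
    have hrmN : 0 < r ^ N - m ^ N := sub_pos.2 (pow_lt_pow_left₀ hmr hm0.le (by omega))
    set D := (m - y k) / (m ^ (N - 1) * (r ^ N - m ^ N)) with hD
    set Q := Real.log ((r - m) / ε) / |Real.log (1 - x)| with hQ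
    -- `D` bounds from below the flow time still missing from `y k` to `m`. Being short of `m` is
    -- possible only if the negative term `Q` pays for it; `x ≤ |log (1 - x)|` then converts this
    -- into a bound on `m ^ N - y k ^ N`.
    have h3 : D / η ≤ -Q := by
      have : flowTime N (r ^ N) (y 0) (y k) / η + D / η ≤ flowTime N (r ^ N) (y 0) m / η := by
        rw [← add_div]; gcongr
      linarith
    have h4 : Real.log (ε / (r - m)) ≤ ε / (r - m) - 1 :=
      Real.log_le_sub_one_of_pos (by positivity)
    have h5 : -Q = Real.log (ε / (r - m)) / |Real.log (1 - x)| := by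
      rw [hQ, ← neg_div, ← Real.log_inv, inv_div]
    have hD0 : 0 ≤ D := div_nonneg (sub_nonneg.2 hkm.le) hgm.le
    have h6 : D / η * x ≤ ε / (r - m) - 1 := by
      have hD0' : 0 ≤ D / η := by positivity
      calc D / η * x ≤ D / η * |Real.log (1 - x)| := by gcongr
        _ ≤ -Q * |Real.log (1 - x)| := by gcongr
        _ = Real.log (ε / (r - m)) := by
          rw [h5, div_mul_cancel₀ _ (by linarith)]
        _ ≤ _ := h4
    have h7 : D / η * x = N * m ^ (N - 1) * (m - y k) / (r ^ N - m ^ N) := by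
      have e : 2 * N - 2 = (N - 1) + (N - 1) := by omega
      rw [hD, hx, e, pow_add]
      field_simp
    have h8 := pow_sub_pow_le_mul_sub hyk.le hkm.le N
    have h9 := pow_sub_pow_le_mul_sub hm0.le hmr.le N
    have h10 : (m ^ N - y k ^ N) / (r ^ N - m ^ N) ≤ ε / (r - m) - 1 := by
      refine le_trans ?_ (h7 ▸ h6)
      gcongr
    have h11 : ε / (r - m) ≤ N * r ^ (N - 1) * ε / (r ^ N - m ^ N) := by
      rw [div_le_div_iff₀ hrm hrmN]
      calc ε * (r ^ N - m ^ N) ≤ ε * (N * r ^ (N - 1) * (r - m)) := by gcongr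
        _ = _ := by ring
    have h12 : (m ^ N - y k ^ N) / (r ^ N - m ^ N)
        ≤ (N * r ^ (N - 1) * ε - (r ^ N - m ^ N)) / (r ^ N - m ^ N) := by
      rw [sub_div (N * r ^ (N - 1) * ε), div_self hrmN.ne']; linarith
    have h13 := (div_le_div_iff_of_pos_right hrmN).1 h12
    linarith

/-! ### Fractional exponents, and passage times from above. -/

theorem rpow_one_sub_one_div {N : ℕ} (hN : N ≠ 0) {x : ℝ} (hx : 0 ≤ x) :
    x ^ (1 - 1 / (N : ℝ)) = (x ^ (1 / (N : ℝ))) ^ (N - 1) := by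
  have hN' : (N : ℝ) ≠ 0 := by exact_mod_cast hN
  rw [← Real.rpow_natCast, ← Real.rpow_mul hx, Nat.cast_sub (by omega)]
  congr 1
  field_simp
  simp

theorem rpow_two_sub_two_div {N : ℕ} (hN : N ≠ 0) {x : ℝ} (hx : 0 ≤ x) :
    x ^ (2 - 2 / (N : ℝ)) = (x ^ (1 / (N : ℝ))) ^ (2 * N - 2) := by
  have hN' : (N : ℝ) ≠ 0 := by exact_mod_cast hN
  rw [← Real.rpow_natCast, ← Real.rpow_mul hx, Nat.cast_sub (by omega)]
  congr 1
  push_cast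
  field_simp

theorem rpow_one_div_pow {N : ℕ} (hN : N ≠ 0) {x : ℝ} (hx : 0 ≤ x) :
    (x ^ (1 / (N : ℝ))) ^ N = x := by
  rw [one_div]; exact Real.rpow_inv_natCast_pow hx hN

/-- For decreasing motion both the orientation and the speed are negative; the signs cancel and
leave the form needed by `euler_decreasing_le`. -/
theorem flowTime_eq_integral_swap (N : ℕ) (lam a b : ℝ) :
    flowTime N lam a b = ∫ z in b..a, 1 / (z ^ (N - 1) * (z ^ N - lam)) := by
  rw [flowTime, intervalIntegral.integral_symm, ← intervalIntegral.integral_neg]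
  congr 1
  ext z
  rw [← neg_sub (z ^ N) lam, mul_neg, one_div, one_div, inv_neg, neg_neg]

/-- Decreasing scalar gradient descent passes `b` within the time of the flow. -/
theorem scalar_gd_le_of_flowTime_le {N : ℕ} {η lam b : ℝ} (hη : 0 < η) (hb : 0 < b)
    (hlam : lam < b ^ N) {y : ℕ → ℝ}
    (hy : ∀ k, y (k + 1) = y k - η * (y k ^ (N - 1) * (y k ^ N - lam))) (hanti : Antitone y)
    {k : ℕ} (hk : flowTime N lam (y 0) b / η ≤ k) : y k ≤ b := by
  have hpow : ∀ z ∈ Set.Ici b, b ^ N ≤ z ^ N := fun z hz => pow_le_pow_left₀ hb.le hz N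
  refine euler_decreasing_le (G := fun z => z ^ (N - 1) * (z ^ N - lam)) (by fun_prop) ?_ ?_ hy
    hanti k ?_
  · intro u hu v hv huv
    have hu0 : 0 ≤ u := hb.le.trans hu
    have h1 := hpow u hu
    have h2 : u ^ N ≤ v ^ N := pow_le_pow_left₀ hu0 huv N
    have h3 : 0 ≤ u ^ N - lam := by linarith
    simp only
    have h4 : u ^ (N - 1) ≤ v ^ (N - 1) := pow_le_pow_left₀ hu0 huv _
    exact mul_le_mul h4 (by linarith) h3 ((pow_nonneg hu0 _).trans h4)
  · intro z hz
    have := hpow z hz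
    exact mul_pos (pow_pos (hb.trans_le hz) _) (by linarith)
  · rw [flowTime_eq_integral_swap, div_le_iff₀ hη] at hk
    linarith

/-! ### Convergence and accuracy of the scalar dynamics. -/

section ScalarGD

variable {N : ℕ} {α η M lam : ℝ} {y : ℕ → ℝ}

/-- For `N ≥ 2` both `N` and `2` are at most `3 N - 2`. The first bound serves the contraction to a
positive root, the second keeps the iterates nonnegative for a nonpositive target. -/
theorem steps_mul_natCast_lt (hN : 2 ≤ N) (hη : 0 < η)
    (hM : η * ((3 * (N : ℝ) - 2) * M ^ (2 * N - 2)) < 1) :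
    η * N * M ^ (2 * N - 2) < 1 ∧ 2 * η * M ^ (2 * N - 2) ≤ 1 := by
  have hN' : (2 : ℝ) ≤ N := by exact_mod_cast hN
  have hMM : 0 ≤ η * M ^ (2 * N - 2) := by
    have : 0 ≤ M ^ (2 * N - 2) := Even.pow_nonneg ⟨N - 1, by omega⟩ M
    positivity
  constructor <;> nlinarith

/-- Scalar gradient descent stays in `[0, M]`. -/
theorem scalar_gd_mem_Icc (hN : 2 ≤ N) (hα : 0 < α) (hη : 0 < η) (hαM : α ≤ M)
    (hM : η * ((3 * (N : ℝ) - 2) * M ^ (2 * N - 2)) < 1) (hlam : |lam| ≤ M ^ N)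
    (hy0 : y 0 = α) (hy : ∀ k, y (k + 1) = y k - η * (y k ^ (N - 1) * (y k ^ N - lam))) (k : ℕ) :
    0 ≤ y k ∧ y k ≤ M := by
  obtain ⟨h1, h2⟩ := steps_mul_natCast_lt hN hη hM
  have hM0 : 0 ≤ M := hα.le.trans hαM
  subst hy0
  rcases le_or_gt lam 0 with hl | hl
  · have := scalar_gd_nonpos hN hη h2 hl ((neg_le_abs lam).trans hlam) hy hα.le hαM k
    exact ⟨this.1, this.2.1.trans hαM⟩
  · set r := lam ^ (1 / (N : ℝ)) with hr
    have hr0 : 0 < r := Real.rpow_pos_of_pos hl _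
    have hrN : r ^ N = lam := rpow_one_div_pow (by omega) hl.le
    rw [← hrN] at hlam
    have hrM : r ≤ M := le_of_pow_le_pow_left₀ (by omega) hM0 ((le_abs_self _).trans hlam)
    rw [← hrN] at hy
    rcases le_total (y 0) r with h | h
    · have := scalar_gd_below hN hη h1.le hrM hy hα.le h k
      exact ⟨hα.le.trans this.1, this.2.1.trans hrM⟩
    · have := scalar_gd_above hN hη h1.le hr0.le hy hαM h k
      exact ⟨hr0.le.trans this.2.1, this.1.trans hαM⟩

/-- The `N`-th power of scalar gradient descent converges to the positive part of the target. -/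
theorem tendsto_scalar_gd_pow (hN : 2 ≤ N) (hα : 0 < α) (hη : 0 < η) (hαM : α ≤ M)
    (hM : η * ((3 * (N : ℝ) - 2) * M ^ (2 * N - 2)) < 1) (hlam : |lam| ≤ M ^ N)
    (hy0 : y 0 = α) (hy : ∀ k, y (k + 1) = y k - η * (y k ^ (N - 1) * (y k ^ N - lam))) :
    Tendsto (fun k => y k ^ N) atTop (𝓝 (max lam 0)) := by
  obtain ⟨h1, h2⟩ := steps_mul_natCast_lt hN hη hM
  have hM0 : 0 ≤ M := hα.le.trans hαM
  have hNpos : 0 < N := by omega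
  have hNpos' : (0 : ℝ) < N := by exact_mod_cast hNpos
  subst hy0
  rcases le_or_gt lam 0 with hl | hl
  · have hb := scalar_gd_nonpos hN hη h2 hl ((neg_le_abs lam).trans hlam) hy hα.le hαM
    have hanti : Antitone y := antitone_nat_of_succ_le fun k => (hb k).2.2
    have hbdd : BddBelow (Set.range y) := ⟨0, by rintro _ ⟨k, rfl⟩; exact (hb k).1⟩
    have hlim := tendsto_atTop_ciInf hanti hbdd
    set L := ⨅ i, y i
    have hL : 0 ≤ L := le_ciInf fun k => (hb k).1
    have hlim' : Tendsto (fun k => y (k + 1)) atTop (𝓝 (L - η * (L ^ (N - 1) * (L ^ N - lam)))) := by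
      simp only [hy]
      exact hlim.sub (((hlim.pow _).mul ((hlim.pow _).sub_const _)).const_mul _)
    -- The monotone limit `L ≥ 0` is a fixed point, so `L = 0` or `L ^ N = lam ≤ 0`; either way `L ^
    -- N = 0`.
    have heq := tendsto_nhds_unique (hlim.comp (tendsto_add_atTop_nat 1)) hlim'
    have hLN : L ^ N = 0 := by
      have : η * (L ^ (N - 1) * (L ^ N - lam)) = 0 := by linarith
      rcases mul_eq_zero.1 this with h | h
      · exact absurd h hη.ne'
      rcases mul_eq_zero.1 h with h | h
      · rw [eq_zero_of_pow_eq_zero h, zero_pow hNpos.ne']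
      · have : 0 ≤ L ^ N := by positivity
        linarith
    rw [max_eq_right hl, ← hLN]
    exact hlim.pow N
  · set r := lam ^ (1 / (N : ℝ)) with hr
    have hr0 : 0 < r := Real.rpow_pos_of_pos hl _
    have hrN : r ^ N = lam := rpow_one_div_pow (by omega) hl.le
    rw [← hrN] at hlam
    have hrM : r ≤ M := le_of_pow_le_pow_left₀ hNpos.ne' hM0 ((le_abs_self _).trans hlam)
    rw [max_eq_left hl.le, ← hrN]
    rw [← hrN] at hy
    refine Tendsto.pow ?_ N
    have hgeo : ∀ m, 0 < m → m ≤ M → ∀ A : ℝ,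
        Tendsto (fun k : ℕ => A * (1 - η * N * m ^ (2 * N - 2)) ^ k) atTop (𝓝 0) := by
      intro m hm hmM A
      have h3 : η * N * m ^ (2 * N - 2) ≤ η * N * M ^ (2 * N - 2) := by gcongr
      have h4 : 0 < η * N * m ^ (2 * N - 2) := by positivity
      simpa using (tendsto_pow_atTop_nhds_zero_of_lt_one (by linarith) (by linarith)).const_mul A
    rw [← tendsto_sub_nhds_zero_iff]
    rcases le_total (y 0) r with h | h
    · have hb := scalar_gd_below hN hη h1.le hrM hy hα.le h
      refine squeeze_zero_norm (fun k => ?_) (hgeo (y 0) hα hαM (r - y 0))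
      rw [Real.norm_eq_abs, abs_sub_comm, abs_of_nonneg (sub_nonneg.2 (hb k).2.1)]
      exact (hb k).2.2.2
    · have hb := scalar_gd_above hN hη h1.le hr0.le hy hαM h
      refine squeeze_zero_norm (fun k => ?_) (hgeo r hr0 hrM (y 0 - r))
      rw [Real.norm_eq_abs, abs_of_nonneg (sub_nonneg.2 (hb k).2.1)]
      exact (hb k).2.2.2

/-- The accuracy of scalar gradient descent after `TId` steps. -/
theorem scalar_gd_error_of_TId_le {ε : ℝ} (hN : 2 ≤ N) (hα : 0 < α) (hε : 0 < ε) (hη : 0 < η)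
    (hαM : α ≤ M)
    (hM : η * ((3 * (N : ℝ) - 2) * M ^ (2 * N - 2)) < 1) (hlam : |lam| ≤ M ^ N)
    (hy0 : y 0 = α) (hy : ∀ k, y (k + 1) = y k - η * (y k ^ (N - 1) * (y k ^ N - lam)))
    {k : ℕ} (hk : TId N lam ε α η ≤ k) :
    (α ^ N ≤ lam → |y k ^ N - max lam 0| ≤ ε * N * lam ^ (1 - 1 / (N : ℝ))) ∧
    (0 < lam → lam < α ^ N →
      |y k ^ N - max lam 0| ≤ (lam ^ (1 / (N : ℝ)) + ε) ^ N - lam) ∧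
    (lam ≤ 0 → |y k ^ N - max lam 0| ≤ ε ^ N) := by
  obtain ⟨h1, h2⟩ := steps_mul_natCast_lt hN hη hM
  have hM0 : 0 ≤ M := hα.le.trans hαM
  have hNpos : 0 < N := by omega
  have hNpos' : (0 : ℝ) < N := by exact_mod_cast hNpos
  subst hy0
  have hαN : 0 < y 0 ^ N := by positivity
  have hgeo : ∀ m, 0 < m → m ≤ M → 0 < 1 - η * N * m ^ (2 * N - 2) ∧
      1 - η * N * m ^ (2 * N - 2) < 1 := by
    intro m hm hmM
    have h3 : η * N * m ^ (2 * N - 2) ≤ η * N * M ^ (2 * N - 2) := by gcongr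
    have h4 : 0 < η * N * m ^ (2 * N - 2) := by positivity
    constructor <;> linarith
  rcases le_or_gt lam 0 with hl | hl
  · refine ⟨fun h => by linarith, fun h => by linarith, fun _ => ?_⟩
    have hb := scalar_gd_nonpos hN hη h2 hl ((neg_le_abs lam).trans hlam) hy hα.le hαM
    have hanti : Antitone y := antitone_nat_of_succ_le fun k => (hb k).2.2
    rw [TId, if_pos hl] at hk
    have := scalar_gd_le_of_flowTime_le hη hε (hl.trans_lt (pow_pos hε N)) hy hanti hk
    rw [max_eq_right hl, sub_zero, abs_of_nonneg (pow_nonneg (hb k).1 N)]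
    exact pow_le_pow_left₀ (hb k).1 this N
  set r := lam ^ (1 / (N : ℝ)) with hr
  have hr0 : 0 < r := Real.rpow_pos_of_pos hl _
  have hrN : r ^ N = lam := rpow_one_div_pow (by omega) hl.le
  have hrM : r ≤ M := le_of_pow_le_pow_left₀ hNpos.ne' hM0
    (hrN ▸ (le_abs_self _).trans hlam)
  have hy' := hy
  rw [← hrN] at hy'
  rw [TId, if_neg hl.not_ge, ← hr] at hk
  rw [max_eq_left hl.le]
  rcases lt_or_ge lam (y 0 ^ N) with hlt | hge
  · refine ⟨fun h => by linarith, fun _ _ => ?_, fun h => by linarith⟩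
    have hry : r < y 0 := lt_of_pow_lt_pow_left₀ N hα.le (hrN ▸ hlt)
    have hb := scalar_gd_above hN hη h1.le hr0.le hy' hαM hry.le
    have hanti : Antitone y := antitone_nat_of_succ_le fun k => (hb k).2.2.1
    rw [if_pos hlt, min_le_iff] at hk
    have hle : y k ≤ r + ε := by
      -- Either count in the minimum suffices: the first by comparison with the flow, the second by
      -- contraction.
      rcases hk with hk | hk
      · refine scalar_gd_le_of_flowTime_le hη (by positivity) ?_ hy hanti hk
        rw [← hrN]
        exact pow_lt_pow_left₀ (by linarith) hr0.le hNpos.ne'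
      · rw [rpow_two_sub_two_div hNpos.ne' hl.le, ← hr] at hk
        have := mul_pow_le_of_log_div_le (hgeo r hr0 hrM).1 (hgeo r hr0 hrM).2
          (sub_nonneg.2 hry.le) hε hk
        linarith [(hb k).2.2.2]
    have h5 : lam ≤ y k ^ N := hrN ▸ pow_le_pow_left₀ hr0.le (hb k).2.1 N
    rw [abs_of_nonneg (sub_nonneg.2 h5)]
    have := pow_le_pow_left₀ (hr0.le.trans (hb k).2.1) hle N
    linarith
  · refine ⟨fun _ => ?_, fun _ h => by linarith, fun h => by linarith⟩
    have hry : y 0 ≤ r := le_of_pow_le_pow_left₀ hNpos.ne' hr0.le (hrN ▸ hge)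
    have hb := scalar_gd_below hN hη h1.le hrM hy' hα.le hry
    have hyk : 0 ≤ y k := hα.le.trans (hb k).1
    have h5 : y k ^ N ≤ lam := hrN ▸ pow_le_pow_left₀ hyk (hb k).2.1 N
    rw [abs_sub_comm, abs_of_nonneg (sub_nonneg.2 h5), rpow_one_sub_one_div hNpos.ne' hl.le, ← hr]
    rw [if_neg hge.not_gt] at hk
    have hNge : (2 : ℝ) ≤ N := by exact_mod_cast hN
    by_cases hc : cConst N * lam ≤ y 0 ^ N
    · rw [if_pos hc] at hk
      have := mul_pow_le_of_log_div_le (hgeo (y 0) hα hαM).1 (hgeo (y 0) hα hαM).2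
          (sub_nonneg.2 hry) hε hk
      have h6 : r - y k ≤ ε := (hb k).2.2.2.trans this
      have h7 := pow_sub_pow_le_mul_sub hyk (hb k).2.1 N
      rw [hrN] at h7
      calc lam - y k ^ N ≤ N * r ^ (N - 1) * (r - y k) := h7
        _ ≤ N * r ^ (N - 1) * ε := by gcongr
        _ = ε * N * r ^ (N - 1) := by ring
    · rw [if_neg hc] at hk
      push Not at hc
      have hcpos : 0 < cConst N := div_pos (by linarith) (by linarith)
      have hcN : cConst N < 1 := (div_lt_one (by linarith)).2 (by linarith)
      set s := cConst N ^ (1 / (N : ℝ)) with hs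
      have hs0 : 0 < s := Real.rpow_pos_of_pos hcpos _
      have hsN : s ^ N = cConst N := rpow_one_div_pow hNpos.ne' hcpos.le
      have hs1 : s < 1 := Real.rpow_lt_one hcpos.le hcN (by positivity)
      have hmu : (cConst N * lam) ^ (1 / (N : ℝ)) = s * r :=
        Real.mul_rpow hcpos.le hl.le
      have hcl : 0 ≤ cConst N * lam := by positivity
      rw [rpow_two_sub_two_div hNpos.ne' hcl, hmu] at hk
      have hlogs : Real.log (1 - s) < 0 := Real.log_neg (by linarith) (by linarith)
      -- As `μ = s r`, the correction `log (1 - s)` replaces the distance `r` by the distance `r -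
      -- μ` left on reaching `μ`.
      have hlog : Real.log (r / ε) - |Real.log (1 - s)| = Real.log ((r - s * r) / ε) := by
        rw [abs_of_neg hlogs, sub_neg_eq_add,
          ← Real.log_mul (by positivity) (by linarith)]
        congr 1
        ring
      rw [hlog] at hk
      have hmN : (s * r) ^ N = cConst N * lam := by rw [mul_pow, hsN, hrN]
      have := scalar_gd_far hN hη hε h1 hrM (mul_pos hs0 hr0) (by nlinarith)
        (by
          rw [hmN, hrN, cConst]
          have : 2 * (N : ℝ) - 1 ≠ 0 := by linarith
          apply le_of_eq
          field_simp) hy' hα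
        (lt_of_pow_lt_pow_left₀ N (by positivity) (by rw [hmN]; exact hc))
        (by rw [hrN]; exact hk)
      rw [hrN] at this
      linarith

end ScalarGD

/-! ### Decoupling of gradient descent in the eigenbasis of the target. -/

section Gradient

open Matrix

variable {n N : ℕ}

theorem factorProd_const (A : Matrix (Fin n) (Fin n) ℝ) :
    factorProd (fun _ : Fin N => A) = A ^ N := by
  rw [factorProd, List.ofFn_const, List.reverse_replicate, List.prod_replicate]

theorem factorProd_update_const (A X : Matrix (Fin n) (Fin n) ℝ) (j : Fin N) :
    factorProd (Function.update (fun _ : Fin N => A) j X)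
      = A ^ (N - 1 - j) * X * A ^ (j : ℕ) := by
  -- Indices start at 0: `j` copies of `A` precede `X` and `N - 1 - j` follow; the reversal in
  -- `factorProd` exchanges the sides.
  have h : List.ofFn (Function.update (fun _ : Fin N => A) j X)
      = List.replicate j A ++ X :: List.replicate (N - 1 - j) A := by
    have hj := j.2
    apply List.ext_getElem
    · simp; omega
    · intro i h1 h2
      simp only [List.length_ofFn] at h1
      rw [List.getElem_ofFn, List.getElem_append]
      rcases lt_trichotomy i j with h | h | h
      · rw [Function.update_of_ne (by simp [Fin.ext_iff]; omega)]
        simp [h]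
      · subst h
        simp
      · rw [Function.update_of_ne (by simp [Fin.ext_iff]; omega)]
        obtain ⟨p, hp⟩ : ∃ p, i - j = p + 1 := ⟨i - j - 1, by omega⟩
        simp [hp, h.not_gt]
  rw [factorProd, h]
  simp [mul_assoc]

/-- The gradient of the loss when all factors equal one matrix `A`. -/
theorem factorGrad_const (Wt A : Matrix (Fin n) (Fin n) ℝ) (j : Fin N) :
    factorGrad Wt (fun _ : Fin N => A) j
      = (A ^ (N - 1 - j))ᵀ * (A ^ N - Wt) * (A ^ (j : ℕ))ᵀ := by
  ext a b
  set P := A ^ (N - 1 - j)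
  set Q := A ^ (j : ℕ)
  set R := A ^ N - Wt with hR
  -- The residual is affine in the varied entry, so the derivative of the loss is its Frobenius
  -- product with the direction `P * single a b 1 * Q`, whose entries are `P x a * Q b y`.
  have hupd : ∀ t : ℝ, factorProd (Function.update (fun _ : Fin N => A) j (A + single a b t)) - Wt
      = R + t • (P * single a b 1 * Q) := by
    intro t
    have hAN : P * A * Q = A ^ N := by
      rw [← pow_succ, ← pow_add]; congr 1; have := j.2; omega
    have hs : single a b t = t • single a b (1 : ℝ) := by simp
    rw [factorProd_update_const, hs, mul_add, add_mul, hAN, hR, mul_smul_comm, smul_mul_assoc]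
    abel
  simp only [factorGrad, of_apply, factorLoss, hupd]
  have hder : ∀ x y, HasDerivAt
      (fun t : ℝ => ((R + t • (P * single a b (1 : ℝ) * Q) : Matrix (Fin n) (Fin n) ℝ) x y) ^ 2)
      (2 * R x y * (P x a * Q b y)) 0 := by
    intro x y
    have hent : (P * single a b (1 : ℝ) * Q : Matrix (Fin n) (Fin n) ℝ) x y = P x a * Q b y := by
      simp [mul_apply, single_apply, ite_and]
    simp only [Matrix.add_apply, Matrix.smul_apply, smul_eq_mul, hent]
    have := (((hasDerivAt_id (0 : ℝ)).mul_const (P x a * Q b y)).const_add (R x y)).pow 2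
    simpa [Pi.pow_def] using this
  have hsum := (HasDerivAt.fun_sum (u := Finset.univ) fun x _ =>
    HasDerivAt.fun_sum (u := Finset.univ) fun y _ => hder x y).const_mul (1 / 2 : ℝ)
  rw [hsum.deriv, mul_apply]
  simp only [mul_apply, transpose_apply, Finset.sum_mul, Finset.mul_sum]
  rw [Finset.sum_comm]
  refine Finset.sum_congr rfl fun x _ => Finset.sum_congr rfl fun y _ => ?_
  ring

/-- Conjugates of diagonal matrices by an orthogonal matrix multiply entrywise. -/
theorem conj_diagonal_mul {U : Matrix (Fin n) (Fin n) ℝ} (hU : Uᵀ * U = 1) (d e : Fin n → ℝ) :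
    (U * diagonal d * Uᵀ) * (U * diagonal e * Uᵀ) = U * diagonal (fun i => d i * e i) * Uᵀ := by
  rw [← diagonal_mul_diagonal]
  calc _ = U * diagonal d * (Uᵀ * U) * diagonal e * Uᵀ := by simp only [mul_assoc]
    _ = _ := by rw [hU]; simp only [mul_assoc, mul_one]

theorem conj_diagonal_pow {U : Matrix (Fin n) (Fin n) ℝ} (hU : Uᵀ * U = 1) (d : Fin n → ℝ)
    (k : ℕ) : (U * diagonal d * Uᵀ) ^ k = U * diagonal (fun i => d i ^ k) * Uᵀ := by
  induction k with
  | zero =>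
    have : U * Uᵀ = 1 := mul_eq_one_comm.1 hU
    simp [this]
  | succ k ih => rw [pow_succ, ih, conj_diagonal_mul hU]; simp only [pow_succ]

theorem transpose_conj_diagonal (U : Matrix (Fin n) (Fin n) ℝ) (d : Fin n → ℝ) :
    (U * diagonal d * Uᵀ)ᵀ = U * diagonal d * Uᵀ := by
  simp [transpose_mul, mul_assoc]

theorem conj_diagonal_sub (U : Matrix (Fin n) (Fin n) ℝ) (d e : Fin n → ℝ) :
    U * diagonal d * Uᵀ - U * diagonal e * Uᵀ = U * diagonal (fun i => d i - e i) * Uᵀ := by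
  rw [← sub_mul, ← mul_sub, diagonal_sub]

/-- Scalar gradient descent with target `lam`, started at `α`. -/
def scalarGD (N : ℕ) (lam α η : ℝ) : ℕ → ℝ
  | 0 => α
  | k + 1 => scalarGD N lam α η k
      - η * (scalarGD N lam α η k ^ (N - 1) * (scalarGD N lam α η k ^ N - lam))

/-- Gradient descent from multiples of the identity decouples in an eigenbasis of the target. -/
theorem gdFactors_eq {U : Matrix (Fin n) (Fin n) ℝ} (hU : Uᵀ * U = 1)
    (lam : Fin n → ℝ) (α η : ℝ) (k : ℕ) :
    gdFactors N (U * diagonal lam * Uᵀ) α η k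
      = fun _ => U * diagonal (fun i => scalarGD N (lam i) α η k) * Uᵀ := by
  induction k with
  | zero =>
    have hU' : U * Uᵀ = 1 := mul_eq_one_comm.1 hU
    funext j
    have : diagonal (fun _ : Fin n => α) = α • (1 : Matrix (Fin n) (Fin n) ℝ) := by
      rw [smul_one_eq_diagonal]
    simp [gdFactors, scalarGD, this, hU']
  | succ k ih =>
    funext j
    simp only [gdFactors, ih, factorGrad_const]
    simp only [conj_diagonal_pow hU, transpose_conj_diagonal, conj_diagonal_sub,
      conj_diagonal_mul hU]
    rw [← smul_mul_assoc, ← mul_smul_comm, ← diagonal_smul, conj_diagonal_sub]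
    congr 3
    funext i
    have hj := j.2
    -- The powers on the two sides of the residual combine to `N - 1`, so `j` disappears and the
    -- factors stay equal.
    have e : N - 1 = (N - 1 - j) + j := by omega
    simp only [scalarGD, Pi.smul_apply, smul_eq_mul]
    conv_rhs => rw [e, pow_add]
    ring

theorem gdProd_eq {U : Matrix (Fin n) (Fin n) ℝ} (hU : Uᵀ * U = 1)
    (lam : Fin n → ℝ) (α η : ℝ) (k : ℕ) :
    gdProd N (U * diagonal lam * Uᵀ) α η k
      = U * diagonal (fun i => scalarGD N (lam i) α η k ^ N) * Uᵀ := by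
  rw [gdProd, gdFactors_eq hU, factorProd_const, conj_diagonal_pow hU]

end Gradient

/-! ### Eigenvalue and eigenvector perturbation bounds. -/

section Perturbation

open Matrix

variable {n : ℕ}

theorem sum_sq_mulVec_le (A : Matrix (Fin n) (Fin n) ℝ) (x : Fin n → ℝ) :
    ∑ i, (A *ᵥ x) i ^ 2 ≤ specNorm A ^ 2 * ∑ i, x i ^ 2 := by
  have h := (toEuclideanCLM (n := Fin n) (𝕜 := ℝ) A).le_opNorm (WithLp.toLp 2 x)
  have h2 := pow_le_pow_left₀ (norm_nonneg _) h 2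
  rw [mul_pow, EuclideanSpace.real_norm_sq_eq, EuclideanSpace.real_norm_sq_eq] at h2
  exact h2

theorem abs_dotProduct_mulVec_le (A : Matrix (Fin n) (Fin n) ℝ) (x : Fin n → ℝ) :
    |x ⬝ᵥ A *ᵥ x| ≤ specNorm A * ∑ i, x i ^ 2 := by
  have h := abs_real_inner_le_norm (WithLp.toLp 2 x : EuclideanSpace ℝ (Fin n))
    (toEuclideanCLM (n := Fin n) (𝕜 := ℝ) A (WithLp.toLp 2 x))
  rw [inner_toEuclideanCLM] at h
  have h1 := (toEuclideanCLM (n := Fin n) (𝕜 := ℝ) A).le_opNorm (WithLp.toLp 2 x)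
  have h2 := EuclideanSpace.real_norm_sq_eq (WithLp.toLp 2 x : EuclideanSpace ℝ (Fin n))
  refine h.trans ((mul_le_mul_of_nonneg_left h1 (norm_nonneg _)).trans (le_of_eq ?_))
  simp only at h2
  rw [← h2, specNorm]
  ring

theorem specNorm_neg (A : Matrix (Fin n) (Fin n) ℝ) : specNorm (-A) = specNorm A := by
  rw [specNorm, map_neg, norm_neg, specNorm]

theorem specNorm_nonneg (A : Matrix (Fin n) (Fin n) ℝ) : 0 ≤ specNorm A := norm_nonneg _

theorem mulVec_dotProduct_mulVec_of_orthogonal {U : Matrix (Fin n) (Fin n) ℝ} (hU : Uᵀ * U = 1)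
    (x z : Fin n → ℝ) : (U *ᵥ x) ⬝ᵥ (U *ᵥ z) = x ⬝ᵥ z := by
  rw [dotProduct_mulVec, ← mulVec_transpose, mulVec_mulVec, hU, one_mulVec]

theorem sum_sq_mulVec_of_orthogonal {U : Matrix (Fin n) (Fin n) ℝ} (hU : Uᵀ * U = 1)
    (x : Fin n → ℝ) : ∑ i, (U *ᵥ x) i ^ 2 = ∑ i, x i ^ 2 := by
  have := mulVec_dotProduct_mulVec_of_orthogonal hU x x
  simpa [dotProduct, pow_two] using this

theorem dotProduct_conj_diagonal_mulVec {U : Matrix (Fin n) (Fin n) ℝ} (hU : Uᵀ * U = 1)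
    (b c : Fin n → ℝ) :
    (U *ᵥ c) ⬝ᵥ ((U * diagonal b * Uᵀ) *ᵥ (U *ᵥ c)) = ∑ j, b j * c j ^ 2 := by
  have : (U * diagonal b * Uᵀ) *ᵥ (U *ᵥ c) = U *ᵥ (diagonal b *ᵥ c) := by
    rw [mulVec_mulVec, mul_assoc, hU, mul_one, mulVec_mulVec]
  rw [this, mulVec_dotProduct_mulVec_of_orthogonal hU]
  simp only [dotProduct, mulVec_diagonal]
  exact Finset.sum_congr rfl fun j _ => by ring

/-- Eigenvalues are bounded by the spectral norm. -/
theorem abs_eigenvalue_le_specNorm {U : Matrix (Fin n) (Fin n) ℝ} (hU : Uᵀ * U = 1)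
    (b : Fin n → ℝ) (i : Fin n) : |b i| ≤ specNorm (U * diagonal b * Uᵀ) := by
  have h := abs_dotProduct_mulVec_le (U * diagonal b * Uᵀ) (U *ᵥ Pi.single i 1)
  rw [dotProduct_conj_diagonal_mulVec hU, sum_sq_mulVec_of_orthogonal hU] at h
  simpa [Pi.single_apply] using h

/-- One half of Weyl's inequality. -/
theorem eigenvalue_le_add_specNorm {U V E : Matrix (Fin n) (Fin n) ℝ} (hU : Uᵀ * U = 1)
    (hV : Vᵀ * V = 1) {a b : Fin n → ℝ} (ha : Antitone a) (hb : Antitone b)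
    (h : V * diagonal a * Vᵀ + E = U * diagonal b * Uᵀ) (i : Fin n) :
    b i ≤ a i + specNorm E := by
  have hV' : V * Vᵀ = 1 := mul_eq_one_comm.1 hV
  -- Courant–Fischer by dimension count: `U c` is to lie in the span of the columns of `U` up to `i`
  -- and in that of the columns of `V` from `i` on. Row `i` of the system is zero, so a nonzero
  -- solution exists. Its Rayleigh quotient is at least `b i` for the perturbed matrix and at most
  -- `a i` for the unperturbed one.
  obtain ⟨c, hc0, hc⟩ : ∃ c : Fin n → ℝ, c ≠ 0 ∧
      (of fun j l => if j < i then (Vᵀ * U) j l else if i < j then (1 : Matrix _ _ ℝ) j l else 0)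
        *ᵥ c = 0 :=
    exists_mulVec_eq_zero_iff.2 (det_eq_zero_of_row_eq_zero i fun l => by simp)
  set w := (Vᵀ * U) *ᵥ c with hw
  have hwz : ∀ j, j < i → w j = 0 := by
    intro j hj
    have := congrFun hc j
    simpa [mulVec, dotProduct, hj, hw] using this
  have hcz : ∀ j, i < j → c j = 0 := by
    intro j hj
    have := congrFun hc j
    simpa [mulVec, dotProduct, hj, hj.not_gt, one_apply] using this
  have hVw : V *ᵥ w = U *ᵥ c := by
    rw [hw, mulVec_mulVec, ← mul_assoc, hV', one_mul]
  have h1 := dotProduct_conj_diagonal_mulVec hU b c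
  have h2 := dotProduct_conj_diagonal_mulVec hV a w
  have hwc : ∑ j, w j ^ 2 = ∑ j, c j ^ 2 := by
    rw [← sum_sq_mulVec_of_orthogonal hV w, hVw, sum_sq_mulVec_of_orthogonal hU]
  rw [hVw] at h2
  have h3 := (le_abs_self _).trans (abs_dotProduct_mulVec_le E (U *ᵥ c))
  rw [sum_sq_mulVec_of_orthogonal hU] at h3
  rw [← h, add_mulVec, dotProduct_add, h2] at h1
  have h4 : b i * ∑ j, c j ^ 2 ≤ ∑ j, b j * c j ^ 2 := by
    rw [Finset.mul_sum]
    refine Finset.sum_le_sum fun j _ => ?_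
    rcases lt_or_ge i j with hj | hj
    · simp [hcz j hj]
    · exact mul_le_mul_of_nonneg_right (hb hj) (sq_nonneg _)
  have h5 : ∑ j, a j * w j ^ 2 ≤ a i * ∑ j, w j ^ 2 := by
    rw [Finset.mul_sum]
    refine Finset.sum_le_sum fun j _ => ?_
    rcases lt_or_ge j i with hj | hj
    · simp [hwz j hj]
    · exact mul_le_mul_of_nonneg_right (ha hj) (sq_nonneg _)
  rw [hwc] at h5
  have hpos : 0 < ∑ j, c j ^ 2 := by
    obtain ⟨j, hj⟩ := Function.ne_iff.1 hc0
    exact Finset.sum_pos' (fun _ _ => sq_nonneg _) ⟨j, Finset.mem_univ _, by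
      have : c j ≠ 0 := hj
      positivity⟩
  refine le_of_mul_le_mul_right ?_ hpos
  rw [add_mul]
  linarith

/-- Weyl's inequality. -/
theorem abs_eigenvalue_sub_le_specNorm {U V E : Matrix (Fin n) (Fin n) ℝ} (hU : Uᵀ * U = 1)
    (hV : Vᵀ * V = 1) {a b : Fin n → ℝ} (ha : Antitone a) (hb : Antitone b)
    (h : V * diagonal a * Vᵀ + E = U * diagonal b * Uᵀ) (i : Fin n) :
    |b i - a i| ≤ specNorm E := by
  have h1 := eigenvalue_le_add_specNorm hU hV ha hb h i
  have h2 := eigenvalue_le_add_specNorm hV hU hb ha (E := -E) (by rw [← h]; abel) i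
  rw [specNorm_neg] at h2
  rw [abs_le]
  constructor <;> linarith

/-- A Davis–Kahan bound for the angle between the `i`-th eigenvectors. -/
theorem one_sub_sq_eigenvector_le {U V E : Matrix (Fin n) (Fin n) ℝ} (hU : Uᵀ * U = 1)
    (hV : Vᵀ * V = 1) {a b : Fin n → ℝ}
    (h : V * diagonal a * Vᵀ + E = U * diagonal b * Uᵀ) {g : ℝ} (hg : 0 ≤ g) (i : Fin n)
    (hgap : ∀ j, j ≠ i → g ≤ |a j - b i|) :
    g ^ 2 * (1 - (Vᵀ * U) i i ^ 2) ≤ specNorm E ^ 2 := by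
  have hV' : V * Vᵀ = 1 := mul_eq_one_comm.1 hV
  have hVt : Vᵀᵀ * Vᵀ = 1 := by rwa [transpose_transpose]
  set e : Fin n → ℝ := Pi.single i 1 with he
  have hes : ∑ j, e j ^ 2 = 1 := by simp [he, Pi.single_apply]
  have hcol : ∀ j, (Vᵀ * U) j i = (Vᵀ *ᵥ (U *ᵥ e)) j := by
    intro j; rw [mulVec_mulVec, he]; simp
  have hunit : ∑ j, (Vᵀ * U) j i ^ 2 = 1 := by
    simp only [hcol]
    rw [sum_sq_mulVec_of_orthogonal hVt, sum_sq_mulVec_of_orthogonal hU, hes]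
  -- In mixed eigenbases the perturbation equation is of Sylvester type: entry `(j, i)` of `Vᵀ E U`
  -- is `(b i - a j)` times that of `Vᵀ U`.
  have hmat : diagonal a * (Vᵀ * U) + Vᵀ * E * U = (Vᵀ * U) * diagonal b := by
    calc diagonal a * (Vᵀ * U) + Vᵀ * E * U
        = (Vᵀ * V) * diagonal a * Vᵀ * U + Vᵀ * E * U := by rw [hV]; simp [mul_assoc]
      _ = Vᵀ * (V * diagonal a * Vᵀ + E) * U := by simp only [mul_add, add_mul, mul_assoc]
      _ = Vᵀ * U * diagonal b * (Uᵀ * U) := by rw [h]; simp only [mul_assoc]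
      _ = _ := by rw [hU, mul_one]
  have hent : ∀ j, (Vᵀ *ᵥ (E *ᵥ (U *ᵥ e))) j = -((a j - b i) * (Vᵀ * U) j i) := by
    intro j
    have h1 := congrFun (congrFun hmat j) i
    rw [Matrix.add_apply, diagonal_mul, mul_diagonal] at h1
    have h2 : (Vᵀ *ᵥ (E *ᵥ (U *ᵥ e))) j = (Vᵀ * E * U) j i := by
      rw [mulVec_mulVec, mulVec_mulVec, he]; simp
    rw [h2]
    linarith
  have hsum := sum_sq_mulVec_le E (U *ᵥ e)
  rw [sum_sq_mulVec_of_orthogonal hU, hes, mul_one, ← sum_sq_mulVec_of_orthogonal hVt] at hsum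
  refine le_trans ?_ hsum
  -- Column `i` is a unit vector, so this is its off-diagonal mass, to which `hgap` applies.
  have hsplit : 1 - (Vᵀ * U) i i ^ 2 = ∑ j ∈ Finset.univ.erase i, (Vᵀ * U) j i ^ 2 := by
    rw [← hunit, ← Finset.add_sum_erase _ _ (Finset.mem_univ i)]; ring
  rw [hsplit, Finset.mul_sum]
  calc ∑ j ∈ Finset.univ.erase i, g ^ 2 * (Vᵀ * U) j i ^ 2
      ≤ ∑ j ∈ Finset.univ.erase i, (Vᵀ *ᵥ (E *ᵥ (U *ᵥ e))) j ^ 2 := by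
        refine Finset.sum_le_sum fun j hj => ?_
        rw [hent, neg_sq, mul_pow, ← sq_abs (a j - b i)]
        have := hgap j (Finset.ne_of_mem_erase hj)
        gcongr
    _ ≤ _ := Finset.sum_le_sum_of_subset_of_nonneg (Finset.subset_univ _)
        fun _ _ _ => sq_nonneg _

/-- A diagonal entry of a matrix with spectrum in `[0, B]`, in another orthonormal basis. -/
theorem abs_conj_diagonal_apply_sub_le {Q : Matrix (Fin n) (Fin n) ℝ} (hQ : Q * Qᵀ = 1)
    {p : Fin n → ℝ} {B : ℝ} (hp : ∀ j, 0 ≤ p j) (hpB : ∀ j, p j ≤ B) (i : Fin n) :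
    |(Q * diagonal p * Qᵀ) i i - p i| ≤ B * (1 - Q i i ^ 2) := by
  have hrow : ∑ j, Q i j ^ 2 = 1 := by
    have := congrFun (congrFun hQ i) i
    simpa [mul_apply, pow_two] using this
  have hval : (Q * diagonal p * Qᵀ) i i = ∑ j, Q i j ^ 2 * p j := by
    rw [mul_apply]
    refine Finset.sum_congr rfl fun j _ => ?_
    rw [mul_diagonal, transpose_apply]; ring
  -- The diagonal entry is an average of the `p j` with weights `Q i j ^ 2`; only the weight off `i`
  -- contributes to its distance from `p i`.
  have hdiff : (Q * diagonal p * Qᵀ) i i - p i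
      = ∑ j ∈ Finset.univ.erase i, Q i j ^ 2 * (p j - p i) := by
    have h1 : p i = ∑ j, Q i j ^ 2 * p i := by rw [← Finset.sum_mul, hrow, one_mul]
    have h2 : (Q * diagonal p * Qᵀ) i i - p i = ∑ j, Q i j ^ 2 * (p j - p i) := by
      simp only [mul_sub, Finset.sum_sub_distrib]
      rw [hval, ← h1]
    rw [h2, ← Finset.add_sum_erase _ _ (Finset.mem_univ i)]
    simp
  have hsplit : 1 - Q i i ^ 2 = ∑ j ∈ Finset.univ.erase i, Q i j ^ 2 := by
    rw [← hrow, ← Finset.add_sum_erase _ _ (Finset.mem_univ i)]; ring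
  rw [hdiff, hsplit, Finset.mul_sum]
  refine (Finset.abs_sum_le_sum_abs _ _).trans (Finset.sum_le_sum fun j _ => ?_)
  rw [abs_mul, abs_of_nonneg (sq_nonneg (Q i j)), mul_comm]
  refine mul_le_mul_of_nonneg_right ?_ (sq_nonneg _)
  rw [abs_le]
  constructor <;> linarith [hp i, hp j, hpB i, hpB j]

end Perturbation

/-! ### Assembly of the main theorem. -/

/-- The condition `n ≥ 2` is contained in `hδ`, since a least element belongs to its set and so
supplies two distinct indices. The three cases of the bound appear as implications. -/
theorem theorem4p4 (n N : ℕ) (hN : 2 ≤ N) (α ε η δ : ℝ) (hα : 0 < α) (hε : 0 < ε)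
    (What E V Vt : Matrix (Fin n) (Fin n) ℝ) (lam lamt : Fin n → ℝ)
    -- eigendecomposition of the symmetric ground truth, with simple positive spectrum
    (hV : V ∈ Matrix.orthogonalGroup (Fin n) ℝ)
    (hWhat : What = V * Matrix.diagonal lam * V.transpose)
    (hlam : StrictAnti lam) (hpos : ∀ i, 0 < lam i)
    -- the smallest distance between two eigenvalues of the ground truth
    (hδ : IsLeast {g : ℝ | ∃ i j, j ≠ i ∧ g = |lam i - lam j|} δ)
    -- the symmetric perturbation
    (hEsymm : E.IsSymm) (hE : specNorm E ≤ δ / 2)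
    -- eigendecomposition of the perturbed matrix
    (hVt : Vt ∈ Matrix.orthogonalGroup (Fin n) ℝ)
    (hWt : What + E = Vt * Matrix.diagonal lamt * Vt.transpose)
    (hlamt : Antitone lamt)
    -- the step size
    (M : ℝ) (hM : M = max α (specNorm (What + E) ^ (1 / (N : ℝ))))
    (hη : 0 < η) (hη' : η < 1 / ((3 * (N : ℝ) - 2) * M ^ (2 * N - 2))) :
    Tendsto (gdProd N (What + E) α η) atTop
        (𝓝 (Vt * Matrix.diagonal (fun i => max (lamt i) 0) * Vt.transpose)) ∧
      ∀ (i : Fin n) (k : ℕ), TId N (lamt i) ε α η ≤ (k : ℝ) →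
        (α ^ N ≤ lamt i →
          |(V.transpose * gdProd N (What + E) α η k * V
              - Matrix.diagonal (fun j => max (lam j) 0)) i i|
            ≤ (4 * √2 * M ^ N / δ + 1) * specNorm E
              + ε * N * lamt i ^ (1 - 1 / (N : ℝ))) ∧
        (0 < lamt i → lamt i < α ^ N →
          |(V.transpose * gdProd N (What + E) α η k * V
              - Matrix.diagonal (fun j => max (lam j) 0)) i i|
            ≤ (4 * √2 * M ^ N / δ + 1) * specNorm E
              + ((lamt i ^ (1 / (N : ℝ)) + ε) ^ N - lamt i)) ∧
        (lamt i ≤ 0 →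
          |(V.transpose * gdProd N (What + E) α η k * V
              - Matrix.diagonal (fun j => max (lam j) 0)) i i|
            ≤ (4 * √2 * M ^ N / δ + 1) * specNorm E + ε ^ N) := by
  have hU : Vt.transpose * Vt = 1 := by
    simpa [Matrix.star_eq_conjTranspose] using (Matrix.mem_orthogonalGroup_iff' (Fin n) ℝ).1 hVt
  have hV1 : V.transpose * V = 1 := by
    simpa [Matrix.star_eq_conjTranspose] using (Matrix.mem_orthogonalGroup_iff' (Fin n) ℝ).1 hV
  have hV2 : V * V.transpose = 1 := mul_eq_one_comm.1 hV1
  have hU2 : Vt * Vt.transpose = 1 := mul_eq_one_comm.1 hU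
  have hN0 : N ≠ 0 := by omega
  have hN' : (2 : ℝ) ≤ N := by exact_mod_cast hN
  have hαM : α ≤ M := hM ▸ le_max_left _ _
  have hM0 : 0 < M := hα.trans_le hαM
  have hMN : specNorm (What + E) ≤ M ^ N := by
    rw [← rpow_one_div_pow hN0 (specNorm_nonneg (What + E))]
    have h0 := specNorm_nonneg (What + E)
    have : specNorm (What + E) ^ (1 / (N : ℝ)) ≤ M := hM ▸ le_max_right _ _
    gcongr
  have hlamtM : ∀ i, |lamt i| ≤ M ^ N := fun i => by
    refine le_trans ?_ hMN
    rw [hWt]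
    exact abs_eigenvalue_le_specNorm hU lamt i
  have hηM : η * ((3 * (N : ℝ) - 2) * M ^ (2 * N - 2)) < 1 := by
    have : 0 < (3 * (N : ℝ) - 2) * M ^ (2 * N - 2) :=
      mul_pos (by linarith) (pow_pos hM0 _)
    exact (lt_div_iff₀ this).1 hη'
  have hprod : ∀ k, gdProd N (What + E) α η k
      = Vt * Matrix.diagonal (fun i => scalarGD N (lamt i) α η k ^ N) * Vt.transpose := fun k => by
    rw [hWt, gdProd_eq hU]
  refine ⟨?_, ?_⟩
  · simp only [funext hprod]
    have hdiag : Tendsto (fun k => fun i => scalarGD N (lamt i) α η k ^ N) atTop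
        (𝓝 (fun i => max (lamt i) 0)) :=
      tendsto_pi_nhds.2 fun i =>
        tendsto_scalar_gd_pow hN hα hη hαM hηM (hlamtM i) rfl fun k => rfl
    have hcont : Continuous fun p : Fin n → ℝ => Vt * Matrix.diagonal p * Vt.transpose := by
      fun_prop
    exact (hcont.tendsto _).comp hdiag
  intro i k hk
  set e := specNorm E with he
  have he0 : 0 ≤ e := specNorm_nonneg E
  have hδpos : 0 < δ := by
    obtain ⟨p, q, hpq, rfl⟩ := hδ.1
    exact abs_pos.2 (sub_ne_zero.2 fun h => hpq (hlam.injective h).symm)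
  have hsum : V * Matrix.diagonal lam * V.transpose + E
      = Vt * Matrix.diagonal lamt * Vt.transpose := by rw [← hWhat, hWt]
  have hweyl := abs_eigenvalue_sub_le_specNorm hU hV1 hlam.antitone hlamt hsum
  -- By Weyl the `i`-th eigenvalue moves by at most `δ / 2`, which leaves half of the gap.
  have hgap : ∀ j, j ≠ i → δ / 2 ≤ |lam j - lamt i| := by
    intro j hj
    have h1 : δ ≤ |lam i - lam j| := hδ.2 ⟨i, j, hj, rfl⟩
    have h2 := hweyl i
    have h3 : |lam i - lam j| ≤ |lamt i - lam i| + |lam j - lamt i| := by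
      rw [abs_sub_comm (lamt i), abs_sub_comm (lam j)]
      exact abs_sub_le _ _ _
    linarith
  have hangle := one_sub_sq_eigenvector_le hU hV1 hsum (by linarith) i hgap
  rw [← he] at hangle
  set Q := V.transpose * Vt with hQdef
  have hQ : Q * Q.transpose = 1 := by
    rw [hQdef, Matrix.transpose_mul, Matrix.transpose_transpose]
    calc V.transpose * Vt * (Vt.transpose * V) = V.transpose * (Vt * Vt.transpose) * V := by
          simp only [mul_assoc]
      _ = 1 := by rw [hU2, mul_one, hV1]
  set s := 1 - Q i i ^ 2 with hs
  -- The angle bound is quadratic in `e`; `e ≤ δ / 2` trades one factor `e` for `δ / 2`, giving a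
  -- linear bound.
  have hsle : δ / 2 * s ≤ e := by
    have h1 : e ^ 2 ≤ e * (δ / 2) := by rw [pow_two]; gcongr
    have h2 : δ / 2 * (δ / 2 * s) ≤ δ / 2 * e := by
      calc δ / 2 * (δ / 2 * s) = (δ / 2) ^ 2 * s := by ring
        _ ≤ _ := hangle
        _ ≤ _ := h1
        _ = _ := by ring
    exact le_of_mul_le_mul_left h2 (by linarith)
  set p : Fin n → ℝ := fun j => scalarGD N (lamt j) α η k ^ N with hp
  have hbox : ∀ j, 0 ≤ scalarGD N (lamt j) α η k ∧ scalarGD N (lamt j) α η k ≤ M := fun j =>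
    scalar_gd_mem_Icc hN hα hη hαM hηM (hlamtM j) rfl (fun k => rfl) k
  have hrot := abs_conj_diagonal_apply_sub_le hQ (p := p) (B := M ^ N)
    (fun j => pow_nonneg (hbox j).1 N) (fun j => pow_le_pow_left₀ (hbox j).1 (hbox j).2 N) i
  rw [← hs] at hrot
  -- The three summands are the rotation error, the scalar gradient descent error and the eigenvalue
  -- shift.
  have hentry : (V.transpose * gdProd N (What + E) α η k * V
      - Matrix.diagonal (fun j => max (lam j) 0)) i i
      = ((Q * Matrix.diagonal p * Q.transpose) i i - p i) + (p i - max (lamt i) 0)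
        + (max (lamt i) 0 - max (lam i) 0) := by
    rw [hprod, Matrix.sub_apply, Matrix.diagonal_apply_eq, hQdef, Matrix.transpose_mul,
      Matrix.transpose_transpose]
    simp only [mul_assoc]
    ring
  have hmax : |max (lamt i) 0 - max (lam i) 0| ≤ e :=
    (abs_max_sub_max_le_abs _ _ _).trans (hweyl i)
  -- The argument gives the constant 2, which is weakened to `4 √2`.
  have hrot' : M ^ N * s ≤ 4 * √2 * M ^ N / δ * e := by
    have h2 : (1 : ℝ) ≤ √2 := Real.one_le_sqrt.2 (by norm_num)
    have hs' : s ≤ 2 * e / δ := by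
      rw [le_div_iff₀ hδpos]; linarith
    calc M ^ N * s ≤ M ^ N * (2 * e / δ) := by gcongr
      _ = 2 * (M ^ N / δ * e) := by ring
      _ ≤ 4 * √2 * (M ^ N / δ * e) := by
        have : 0 ≤ M ^ N / δ * e := by positivity
        gcongr
        linarith
      _ = _ := by ring
  have htri : ∀ B, |p i - max (lamt i) 0| ≤ B →
      |(V.transpose * gdProd N (What + E) α η k * V
        - Matrix.diagonal (fun j => max (lam j) 0)) i i|
        ≤ (4 * √2 * M ^ N / δ + 1) * e + B := by
    intro B hB
    rw [hentry]
    refine (abs_add_three _ _ _).trans ?_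
    linarith
  obtain ⟨h1, h2, h3⟩ := scalar_gd_error_of_TId_le hN hα hε hη hαM hηM (hlamtM i)
    (y := scalarGD N (lamt i) α η) rfl (fun k => rfl) hk
  exact ⟨fun h => htri _ (h1 h), fun h h' => htri _ (h2 h h'), fun h => htri _ (h3 h)⟩
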